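/- Let $E$ be a measurable space, $\Pi$ a Markov kernel on $E$, and $\alpha\in(0,1)$. Let $X=(X_n)_{n\ge 0}$ be a homogeneous Markov process with state space $E$ and transition kernel $\Pi$, started in $x$ under the probability measure $\mathbb P_x$ (expectation $\mathbb E_x$), $x\in E$. On the same space let $\xi^{(i)}_n$, $i=1,2$, $n\ge 0$, be independent random variables, uniform on $(0,1)$, and let $T$ be a random time with $\mathbb P_x(T=k)=\alpha^k(1-\alpha)$, $k\ge 0$, such that $X$, $(\xi^{(i)}_n)_{i,n}$ and $T$ are independent under each $\mathbb P_x$. Let $\tilde X$ be the process $X$ killed at each step with probability $1-\alpha$: $\tilde X_n=X_n$ for $n\le T$, and $\tilde X_n$ is a cemetery state, at which all functions take the value $0$, for $n>T$. Let $f_1,g_1,h_1:E\to\mathbb R$ be measurable functions such that $$\sup_{n\ge0}|f_1(\tilde X_n)|,\quad \sup_{n\ge0}|g_1(\tilde X_n)|,\quad \sup_{n\ge0}|h_1(\tilde X_n)|$$ are integrable under $\mathbb P_x$ for every $x\in E$. Let $\mathcal M(E,[0,1])$ be the set of measurable functions $p:E\to[0,1]$ (Markovian strategies); player $i$ using $p$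 stops at $\tau^{p}=\inf\{n\ge0: p(X_n)\ge\xi^{(i)}_n\}$, where $\inf\emptyset=\infty$. For stopping times $\tau_1,\tau_2$ of the two players, player 1 has the expected reward $$J_1(x;\tau_1,\tau_2)=\mathbb E_x\big[\alpha^{\tau_1}f_1(X_{\tau_1})1_{\{\tau_1<\tau_2\}}+\alpha^{\tau_2}g_1(X_{\tau_2})1_{\{\tau_2<\tau_1\}}+\alpha^{\tau_1}h_1(X_{\tau_1})1_{\{\tau_1=\tau_2<\infty\}}\big].$$ For $p^{(2)}\in\mathcal M(E,[0,1])$ let $$\mathrm{BR}^{(1)}(p^{(2)})=\bigcap_{x\in E}\ \operatorname*{arg\,max}_{p^{(1)}\in\mathcal M(E,[0,1])}J_1\big(x;\tau^{p^{(1)}},\tau^{p^{(2)}}\big)$$ be the set of Markovian strategies of player 1 that are optimal responses to $p^{(2)}$ among Markovian strategies, simultaneously from every initial state. Then, for every $p^{(2)}\in\mathcal M(E,[0,1])$, the set $\mathrm{BR}^{(1)}(p^{(2)})$ is non-empty, convex, and closed in $\mathcal M(E,[0,1])$ with respect to the product topology (the topology of pointwise convergence). -/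

import Mathlib

open MeasureTheory ProbabilityTheory
open scoped ENNReal

/-- `X` is, under the family of laws `P x`, a time-homogeneous Markov process with transition
kernel `κ`, started in `x` under `P x`. The Markov property is
`P x (X (n+1) ∈ B | X 0, …, X n) = κ (X n) B` almost surely, written out by integrating over the
events `A` of the `σ`-algebra generated by `X 0, …, X n`. -/
structure IsHomogeneousMarkovProcess {E Ω : Type*} [MeasurableSpace E] [MeasurableSpace Ω]
    (κ : Kernel E E) (P : E → Measure Ω) (X : ℕ → Ω → E) : Prop where
  isProbabilityMeasure : ∀ x, IsProbabilityMeasure (P x)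
  measurable : ∀ n, Measurable (X n)
  initial : ∀ x, (P x).map (X 0) = Measure.dirac x
  markov : ∀ (x : E) (n : ℕ) (A : Set Ω) (B : Set E),
    MeasurableSet[⨆ k : Fin (n + 1), MeasurableSpace.comap (X k) inferInstance] A →
    MeasurableSet B →
    P x (A ∩ X (n + 1) ⁻¹' B) = ∫⁻ ω in A, κ (X n ω) B ∂(P x)

/-- The probabilistic setting of the game: a Markov process `X`, the randomization devices
`ξ i n` of the two players (`i = 0` is player 1 and `i = 1` is player 2), all of them independent
and uniform on `(0, 1)`, and the last time `T` at which the process is still alive when it is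
killed at each step with probability `1 - α`, so that `T` is geometric. The process `X`, the
devices `ξ` and `T` are independent. -/
structure IsDynkinSetting {E Ω : Type*} [MeasurableSpace E] [MeasurableSpace Ω]
    (κ : Kernel E E) (α : ℝ) (P : E → Measure Ω) (X : ℕ → Ω → E) (ξ : Fin 2 → ℕ → Ω → ℝ)
    (T : Ω → ℕ) : Prop where
  process : IsHomogeneousMarkovProcess κ P X
  measurable_device : ∀ i n, Measurable (ξ i n)
  uniform_device : ∀ x i n, (P x).map (ξ i n) = volume.restrict (Set.Ioo (0 : ℝ) 1)
  iIndepFun_device : ∀ x, iIndepFun (fun (k : Fin 2 × ℕ) => ξ k.1 k.2) (P x)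
  measurable_lifetime : Measurable T
  geometric_lifetime : ∀ x k, P x {ω | T ω = k} = ENNReal.ofReal (α ^ k * (1 - α))
  indepFun_device_lifetime : ∀ x, IndepFun (fun ω i n => ξ i n ω) T (P x)
  indepFun_process : ∀ x,
    IndepFun (fun ω n => X n ω) (fun ω => ((fun i n => ξ i n ω), T ω)) (P x)

/-- The killed process: it agrees with `X` up to time `T` and is in the cemetery `none` afterwards. -/
def killedProcess {E Ω : Type*} (X : ℕ → Ω → E) (T : Ω → ℕ) (n : ℕ) (ω : Ω) : Option E :=
  if n ≤ T ω then some (X n ω) else none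

/-- A function on `E`, extended by the value `0` at the cemetery. -/
def extendByZero {E : Type*} (u : E → ℝ) : Option E → ℝ
  | some y => u y
  | none => 0

/-- `sup_n |u(X̃_n)|` is integrable under every `P x`, where `X̃` is the killed process. -/
def IntegrableSupKilled {E Ω : Type*} [MeasurableSpace Ω] (P : E → Measure Ω)
    (X : ℕ → Ω → E) (T : Ω → ℕ) (u : E → ℝ) : Prop :=
  ∀ x, ∫⁻ ω, ⨆ n : ℕ, ‖extendByZero u (killedProcess X T n ω)‖ₑ ∂(P x) < ∞

/-- `𝓜(E, [0, 1])`: measurable functions with values in `[0, 1]`, the Markovian strategies. -/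
def markovStrategies (E : Type*) [MeasurableSpace E] : Set (E → ℝ) :=
  {p | Measurable p ∧ ∀ x, p x ∈ Set.Icc (0 : ℝ) 1}

/-- The Markovian randomized stopping time `inf {n : p (X n) ≥ ξ n}`, with `inf ∅ = ∞`. -/
noncomputable def markovStoppingTime {E Ω : Type*} (X : ℕ → Ω → E) (ξ : ℕ → Ω → ℝ) (p : E → ℝ)
    (ω : Ω) : ℕ∞ :=
  ⨅ (n : ℕ) (_ : ξ n ω ≤ p (X n ω)), (n : ℕ∞)

/-- The discounted reward of player 1 when the players stop at `τ₁` and `τ₂`: it is paid by `f` if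
player 1 stops first, by `g` if player 2 stops first, by `h` if they stop simultaneously at a
finite time, and it is `0` if nobody ever stops. -/
noncomputable def reward {E Ω : Type*} (α : ℝ) (f g h : E → ℝ) (X : ℕ → Ω → E)
    (τ₁ τ₂ : Ω → ℕ∞) (ω : Ω) : ℝ :=
  if τ₁ ω < τ₂ ω then α ^ (τ₁ ω).toNat * f (X (τ₁ ω).toNat ω)
  else if τ₂ ω < τ₁ ω then α ^ (τ₂ ω).toNat * g (X (τ₂ ω).toNat ω)
  else if τ₁ ω < ⊤ then α ^ (τ₁ ω).toNat * h (X (τ₁ ω).toNat ω)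
  else 0

/-- The expected reward `J₁(x; τ₁, τ₂)` of player 1. -/
noncomputable def expectedReward {E Ω : Type*} [MeasurableSpace Ω] (α : ℝ) (f g h : E → ℝ)
    (P : E → Measure Ω) (X : ℕ → Ω → E) (x : E) (τ₁ τ₂ : Ω → ℕ∞) : ℝ :=
  ∫ ω, reward α f g h X τ₁ τ₂ ω ∂(P x)

/-- The Markovian strategies of player 1 that maximize the expected reward from the initial state
`x` among all Markovian strategies, given the Markovian strategy `p₂` of player 2. -/
def bestResponseAt {E Ω : Type*} [MeasurableSpace E] [MeasurableSpace Ω] (α : ℝ) (f g h : E → ℝ)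
    (P : E → Measure Ω) (X : ℕ → Ω → E) (ξ : Fin 2 → ℕ → Ω → ℝ) (x : E) (p₂ : E → ℝ) :
    Set (E → ℝ) :=
  {p ∈ markovStrategies E | IsMaxOn (fun q => expectedReward α f g h P X x
    (markovStoppingTime X (ξ 0) q) (markovStoppingTime X (ξ 1) p₂)) (markovStrategies E) p}

/-- The best responses of player 1 to `p₂`: the Markovian strategies that are optimal
simultaneously from all initial states. -/
def bestResponse {E Ω : Type*} [MeasurableSpace E] [MeasurableSpace Ω] (α : ℝ) (f g h : E → ℝ)
    (P : E → Measure Ω) (X : ℕ → Ω → E) (ξ : Fin 2 → ℕ → Ω → ℝ) (p₂ : E → ℝ) : Set (E → ℝ) :=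
  ⋂ x : E, bestResponseAt α f g h P X ξ x p₂

/-! Against a fixed Markovian strategy `q` of player 2, player 1 faces a Markovian optimal stopping
problem. Write `A = (1 - q) f + q h` for the value of stopping and `C v = q g + (1 - q) α κ v` for
that of going on. The reward `J` of a strategy `p` satisfies `J = p A + (1 - p) C J`, and the
Bellman equation `V = max A (C V)` has a solution. Comparing the two equations gives `J ≤ V`, with
equality everywhere exactly when `p A + (1 - p) C V = max A (C V)` at every state. The pure strategy
that stops where `C V ≤ A` attains `V`, so being optimal from every initial state means `J = V`. At
each state this condition is one affine equation in `p x`, whence convexity and closedness.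

The payoffs may be unbounded, so no sup-norm contraction is available. The weight `W = ∑ αⁿ κⁿ (|f|
+ |g| + |h|)` replaces it: it is finite because the supremum over the killed path dominates the
payoff at time `T`. Value iteration descends from `W` to `V` (`exists_value`), and comparison holds
among functions bounded by `W`, since `αⁿ κⁿ W` tends to `0` (`eq_zero_of_le_killedOp`,
`le_of_sub_le_mul_integral`).

The probabilistic input is `IsDynkinSetting.expectedReward_eq`: after integrating out the devices,
the Markov property turns the positive and negative parts of the reward into potentials. -/

/-- The sub-Markovian operator `v ↦ c · κ v`. -/
noncomputable def killedOp {E : Type*} [MeasurableSpace E] (κ : Kernel E E) (c v : E → ℝ≥0∞) :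
    E → ℝ≥0∞ :=
  fun x => c x * ∫⁻ y, v y ∂κ x

/-- The potential `∑ₙ (c · κ)ⁿ v`. -/
noncomputable def potential {E : Type*} [MeasurableSpace E] (κ : Kernel E E) (c v : E → ℝ≥0∞) :
    E → ℝ≥0∞ :=
  fun x => ∑' n, (killedOp κ c)^[n] v x

/-! ### Potentials of sub-Markovian operators -/

section Potential

variable {E : Type*} [MeasurableSpace E] {κ : Kernel E E} {c c' v v' : E → ℝ≥0∞}

theorem measurable_killedOp (hc : Measurable c) (hv : Measurable v) :
    Measurable (killedOp κ c v) :=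
  hc.mul hv.lintegral_kernel

theorem measurable_killedOp_iterate (hc : Measurable c) (hv : Measurable v) (n : ℕ) :
    Measurable ((killedOp κ c)^[n] v) := by
  induction n generalizing v with
  | zero => exact hv
  | succ n ih => exact ih (measurable_killedOp hc hv)

theorem measurable_potential (hc : Measurable c) (hv : Measurable v) :
    Measurable (potential κ c v) :=
  Measurable.tsum fun n => measurable_killedOp_iterate hc hv n

theorem killedOp_mono (hc : c ≤ c') (hv : v ≤ v') :
    killedOp κ c v ≤ killedOp κ c' v' :=
  fun x => mul_le_mul' (hc x) (lintegral_mono hv)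

theorem killedOp_iterate_mono (hc : c ≤ c') (hv : v ≤ v') (n : ℕ) :
    (killedOp κ c)^[n] v ≤ (killedOp κ c')^[n] v' := by
  induction n generalizing v v' with
  | zero => exact hv
  | succ n ih => exact ih (killedOp_mono hc hv)

theorem potential_mono (hc : c ≤ c') (hv : v ≤ v') : potential κ c v ≤ potential κ c' v' :=
  fun x => ENNReal.tsum_le_tsum fun n => killedOp_iterate_mono hc hv n x

theorem killedOp_tsum (u : ℕ → E → ℝ≥0∞) (hu : ∀ n, Measurable (u n)) :
    killedOp κ c (fun x => ∑' n, u n x) = fun x => ∑' n, killedOp κ c (u n) x := by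
  ext x
  simp only [killedOp]
  rw [lintegral_tsum fun n => (hu n).aemeasurable, ENNReal.tsum_mul_left]

/-- The term `n = 0` is split off; the remaining series is the operator applied to the whole series,
because sum and integral commute for nonnegative functions. -/
theorem potential_eq (hc : Measurable c) (hv : Measurable v) (x : E) :
    potential κ c v x = v x + c x * ∫⁻ y, potential κ c v y ∂κ x := by
  have h := congrFun (killedOp_tsum (κ := κ) (c := c) (fun n => (killedOp κ c)^[n] v)
    (measurable_killedOp_iterate hc hv)) x
  change _ = v x + killedOp κ c (potential κ c v) x
  rw [show killedOp κ c (potential κ c v) x = _ from h, potential,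
    tsum_eq_zero_add' ENNReal.summable]
  simp only [Function.iterate_succ_apply', Function.iterate_zero, id]

theorem killedOp_iterate_add (hc : Measurable c) (hv : Measurable v) (n : ℕ) :
    (killedOp κ c)^[n] (fun y => v y + v' y) =
      fun y => (killedOp κ c)^[n] v y + (killedOp κ c)^[n] v' y := by
  induction n with
  | zero => rfl
  | succ n ih =>
    simp only [Function.iterate_succ_apply', ih]
    ext y
    simp only [killedOp]
    rw [lintegral_add_left (measurable_killedOp_iterate hc hv n), mul_add]

theorem potential_add (hc : Measurable c) (hv : Measurable v) (x : E) :
    potential κ c (fun y => v y + v' y) x = potential κ c v x + potential κ c v' x := by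
  simp only [potential, killedOp_iterate_add hc hv, ENNReal.tsum_add]

theorem killedOp_iterate_potential (hc : Measurable c) (hv : Measurable v) (n : ℕ) :
    (killedOp κ c)^[n] (potential κ c v) = fun x => ∑' k, (killedOp κ c)^[k + n] v x := by
  induction n with
  | zero => rfl
  | succ n ih =>
    rw [Function.iterate_succ_apply', ih,
      killedOp_tsum _ fun k => measurable_killedOp_iterate hc hv _]
    simp only [← Function.iterate_succ_apply' (killedOp κ c), Nat.succ_eq_add_one, add_assoc]

theorem killedOp_iterate_const_mul (b : ℝ≥0∞) (hb : b ≠ ∞) (n : ℕ) :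
    (killedOp κ c)^[n] (fun x => b * v x) = fun x => b * (killedOp κ c)^[n] v x := by
  induction n with
  | zero => rfl
  | succ n ih =>
    rw [Function.iterate_succ_apply', ih]
    ext x
    simp only [killedOp, Function.iterate_succ_apply']
    rw [lintegral_const_mul' _ _ hb, mul_left_comm]

/-- A subsolution of `d = c · κ d` that is dominated by a finite potential vanishes. -/
theorem eq_zero_of_le_killedOp (hc : Measurable c) (hv : Measurable v)
    (hfin : ∀ x, potential κ c v x ≠ ∞) {d : E → ℝ≥0∞} {b : ℝ≥0∞} (hb : b ≠ ∞)
    (hd : d ≤ killedOp κ c d) (hdb : d ≤ fun x => b * potential κ c v x) : d = 0 := by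
  have h1 : ∀ n, d ≤ (killedOp κ c)^[n] d := by
    intro n
    induction n with
    | zero => exact le_rfl
    | succ n ih =>
      rw [Function.iterate_succ_apply']
      exact hd.trans (killedOp_mono le_rfl ih)
  ext x
  -- Iterating the subsolution inequality bounds `d` by `b` times the `n`-th tail of the convergent
  -- series that defines the potential.
  have h2 : ∀ n, d x ≤ b * ∑' k, (killedOp κ c)^[k + n] v x := fun n => by
    have := ((h1 n).trans (killedOp_iterate_mono (κ := κ) le_rfl hdb n)) x
    rwa [killedOp_iterate_const_mul b hb, killedOp_iterate_potential hc hv] at this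
  have h3 : Filter.Tendsto (fun n => b * ∑' k, (killedOp κ c)^[k + n] v x) Filter.atTop
      (nhds (b * 0)) :=
    ENNReal.Tendsto.const_mul (ENNReal.tendsto_sum_nat_add _ (hfin x)) (Or.inr hb)
  rw [mul_zero] at h3
  exact le_antisymm (ge_of_tendsto' h3 h2) bot_le

end Potential

/-! ### The Markov property for functions -/

section Markov

variable {E Ω : Type*} [MeasurableSpace E] [MeasurableSpace Ω] {κ : Kernel E E}
  {P : E → Measure Ω} {X : ℕ → Ω → E}

/-- The definition covers only indicators. It is extended first in the past factor `φ`, then in the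
future factor `v`, each time as an equality of measures. -/
theorem IsHomogeneousMarkovProcess.lintegral_mul_succ [IsMarkovKernel κ]
    (hX : IsHomogeneousMarkovProcess κ P X) (x : E) (n : ℕ) {φ : Ω → ℝ≥0∞}
    (hφ : Measurable[⨆ k : Fin (n + 1), MeasurableSpace.comap (X k) inferInstance] φ)
    {v : E → ℝ≥0∞} (hv : Measurable v) :
    ∫⁻ ω, φ ω * v (X (n + 1) ω) ∂P x = ∫⁻ ω, φ ω * ∫⁻ y, v y ∂κ (X n ω) ∂P x := by
  have hle : (⨆ k : Fin (n + 1), MeasurableSpace.comap (X k) inferInstance) ≤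
      (inferInstance : MeasurableSpace Ω) := iSup_le fun k => (hX.measurable k).comap_le
  have hφ' : Measurable φ := hφ.mono hle le_rfl
  have hset : ∀ B, MeasurableSet B →
      ∫⁻ ω in X (n + 1) ⁻¹' B, φ ω ∂P x = ∫⁻ ω, φ ω * κ (X n ω) B ∂P x := by
    intro B hB
    have hκB : Measurable fun ω => κ (X n ω) B := (κ.measurable_coe hB).comp (hX.measurable n)
    -- Both measures agree on every event of the past, and `φ` is measurable with respect to the
    -- past.
    have h1 : ((P x).restrict (X (n + 1) ⁻¹' B)).trim hle =
        ((P x).withDensity fun ω => κ (X n ω) B).trim hle := by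
      refine @Measure.ext _ (_) _ _ fun A hA => ?_
      rw [trim_measurableSet_eq hle hA, trim_measurableSet_eq hle hA,
        Measure.restrict_apply (hle _ hA), withDensity_apply _ (hle _ hA), hX.markov x n A B hA hB]
    rw [← lintegral_trim hle hφ, h1, lintegral_trim hle hφ,
      lintegral_withDensity_eq_lintegral_mul _ hκB hφ']
    simp only [Pi.mul_apply, mul_comm]
  have hXn := hX.measurable n
  have hXs := hX.measurable (n + 1)
  have h2 : ((P x).withDensity φ).map (X (n + 1)) = (((P x).withDensity φ).map (X n)).bind κ := by
    ext B hB
    rw [Measure.map_apply hXs hB, withDensity_apply _ (hXs hB), hset B hB,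
      Measure.bind_apply hB κ.aemeasurable, lintegral_map (κ.measurable_coe hB) hXn,
      lintegral_withDensity_eq_lintegral_mul _ hφ' (g := fun ω => κ (X n ω) B)
        ((κ.measurable_coe hB).comp hXn)]
    rfl
  have h3 : ∫⁻ y, v y ∂_ = ∫⁻ y, v y ∂_ := congrArg (fun μ => ∫⁻ y, v y ∂μ) h2
  rw [lintegral_map hv hXs, Measure.lintegral_bind κ.aemeasurable hv.aemeasurable,
    lintegral_map hv.lintegral_kernel hXn,
    lintegral_withDensity_eq_lintegral_mul _ hφ' (g := fun ω => v (X (n + 1) ω)) (hv.comp hXs),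
    lintegral_withDensity_eq_lintegral_mul _ hφ' (g := fun ω => ∫⁻ y, v y ∂κ (X n ω))
      (hv.lintegral_kernel.comp hXn)] at h3
  exact h3

/-- A discrete Feynman–Kac formula: the Markov property absorbs the last step into `v`, so the
induction has to run over all `v`. -/
theorem IsHomogeneousMarkovProcess.lintegral_prod_mul [IsMarkovKernel κ]
    (hX : IsHomogeneousMarkovProcess κ P X) (x : E) {c v : E → ℝ≥0∞} (hc : Measurable c)
    (hv : Measurable v) (n : ℕ) :
    ∫⁻ ω, (∏ k ∈ Finset.range n, c (X k ω)) * v (X n ω) ∂P x = (killedOp κ c)^[n] v x := by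
  induction n generalizing v with
  | zero =>
    simp only [Finset.range_zero, Finset.prod_empty, one_mul, Function.iterate_zero, id]
    rw [← lintegral_map hv (hX.measurable 0), hX.initial, lintegral_dirac' _ hv]
  | succ n ih =>
    rw [hX.lintegral_mul_succ x n _ hv, Function.iterate_succ_apply,
      ← ih (measurable_killedOp hc hv)]
    · simp only [Finset.prod_range_succ, killedOp, mul_assoc]
    · refine Finset.measurable_prod _ fun k hk => ?_
      have : Measurable[⨆ k : Fin (n + 1), MeasurableSpace.comap (X k) inferInstance] (X k) := by
        rw [measurable_iff_comap_le]
        exact le_iSup (fun k : Fin (n + 1) => MeasurableSpace.comap (X k) inferInstance)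
          ⟨k, Finset.mem_range.1 hk⟩
      exact hc.comp this

end Markov

/-! ### Integrating out the randomization devices -/

section Devices

variable {E Ω : Type*} [MeasurableSpace E] [MeasurableSpace Ω] {κ : Kernel E E} {α : ℝ}
  {P : E → Measure Ω} {X : ℕ → Ω → E} {ξ : Fin 2 → ℕ → Ω → ℝ} {T : Ω → ℕ}

/-- The randomization devices can be integrated out, conditionally on the process. -/
theorem IsDynkinSetting.lintegral_prod_device (hset : IsDynkinSetting κ α P X ξ T) (x : E)
    (s : Finset (Fin 2 × ℕ)) {ψ : Fin 2 × ℕ → E → ℝ → ℝ≥0∞}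
    (hψ : ∀ j, Measurable (Function.uncurry (ψ j))) {v : E → ℝ≥0∞} (hv : Measurable v) (n : ℕ) :
    ∫⁻ ω, (∏ j ∈ s, ψ j (X j.2 ω) (ξ j.1 j.2 ω)) * v (X n ω) ∂P x =
      ∫⁻ ω, (∏ j ∈ s, ∫⁻ t in Set.Ioo (0 : ℝ) 1, ψ j (X j.2 ω) t) * v (X n ω) ∂P x := by
  have := hset.process.isProbabilityMeasure x
  have hXm : Measurable fun ω n => X n ω := measurable_pi_lambda _ hset.process.measurable
  have hξm : Measurable fun ω i n => ξ i n ω :=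
    measurable_pi_lambda _ fun i => measurable_pi_lambda _ fun n => hset.measurable_device i n
  have hind : IndepFun (fun ω n => X n ω) (fun ω i n => ξ i n ω) (P x) :=
    (hset.indepFun_process x).comp measurable_id measurable_fst
  have hmap := (indepFun_iff_map_prod_eq_prod_map_map hXm.aemeasurable hξm.aemeasurable).1 hind
  have hψj : ∀ j (a : E), Measurable (ψ j a) := fun j a => (hψ j).comp measurable_prodMk_left
  let G : (ℕ → E) × (Fin 2 → ℕ → ℝ) → ℝ≥0∞ :=
    fun z => (∏ j ∈ s, ψ j (z.1 j.2) (z.2 j.1 j.2)) * v (z.1 n)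
  have hG : Measurable G := by
    refine (Finset.measurable_prod _ fun j _ => ?_).mul (hv.comp (by fun_prop))
    exact (hψ j).comp (f := fun z : (ℕ → E) × (Fin 2 → ℕ → ℝ) => (z.1 j.2, z.2 j.1 j.2))
      (by fun_prop)
  -- By independence the path can be frozen at `ω` while an independent `ω'` drives the devices.
  have h1 : ∫⁻ ω, G (fun n => X n ω, fun i n => ξ i n ω) ∂P x =
      ∫⁻ ω, ∫⁻ ω', G (fun n => X n ω, fun i n => ξ i n ω') ∂P x ∂P x := by
    rw [← lintegral_map (f := G) hG (hXm.prodMk hξm), hmap,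
      lintegral_prod _ hG.aemeasurable, lintegral_map hG.lintegral_prod_right' hXm]
    refine lintegral_congr fun ω => ?_
    exact lintegral_map (f := fun z => G (fun n => X n ω, z)) (hG.comp measurable_prodMk_left) hξm
  refine h1.trans (lintegral_congr fun ω => ?_)
  simp only [G]
  have hm : ∀ j : Fin 2 × ℕ, Measurable fun ω' => ψ j (X j.2 ω) (ξ j.1 j.2 ω') :=
    fun j => (hψj j _).comp (hset.measurable_device _ _)
  rw [lintegral_mul_const _ (Finset.measurable_prod _ fun j _ => hm j),
    lintegral_prod_eq_prod_lintegral_of_indepFun s (fun j ω' => ψ j (X j.2 ω) (ξ j.1 j.2 ω'))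
      ((hset.iIndepFun_device x).comp (fun j => ψ j (X j.2 ω)) fun j => hψj j _) hm]
  congr 1
  refine Finset.prod_congr rfl fun j _ => ?_
  rw [← hset.uniform_device x j.1 j.2, lintegral_map (hψj j _) (hset.measurable_device _ _)]

open Classical in
/-- The indicator of the event that a player who uses `p` in state `y` with device `t` stops
(if `b`), respectively goes on (if not `b`). -/
noncomputable def stopIndicator (b : Bool) (p : E → ℝ) (y : E) (t : ℝ) : ℝ≥0∞ :=
  if b = decide (t ≤ p y) then 1 else 0

/-- The probability of stopping (if `b`), respectively of going on (if not `b`). -/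
noncomputable def stopProb (b : Bool) (p : E → ℝ) (y : E) : ℝ≥0∞ :=
  ENNReal.ofReal (if b then p y else 1 - p y)

theorem measurable_stopIndicator (b : Bool) {p : E → ℝ} (hp : Measurable p) :
    Measurable (Function.uncurry (stopIndicator b p)) := by
  have h : MeasurableSet {z : E × ℝ | z.2 ≤ p z.1} :=
    measurableSet_le measurable_snd (hp.comp measurable_fst)
  cases b
  · refine Measurable.ite (p := fun z : E × ℝ => false = decide (z.2 ≤ p z.1)) ?_
      measurable_const measurable_const
    convert h.compl using 1
    ext z
    simp
  · refine Measurable.ite (p := fun z : E × ℝ => true = decide (z.2 ≤ p z.1)) ?_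
      measurable_const measurable_const
    convert h using 1
    ext z
    simp

theorem measurable_stopProb (b : Bool) {p : E → ℝ} (hp : Measurable p) :
    Measurable (stopProb b p) := by
  refine Measurable.ennreal_ofReal ?_
  cases b
  · simp only [Bool.false_eq_true, if_false]
    fun_prop
  · simpa using hp

theorem stopProb_le_one (b : Bool) {p : E → ℝ} (hp : p ∈ markovStrategies E) (y : E) :
    stopProb b p y ≤ 1 := by
  have h := hp.2 y
  refine ENNReal.ofReal_le_one.2 ?_
  cases b <;> simp [h.1, h.2]

theorem lintegral_stopIndicator (b : Bool) {p : E → ℝ} (hp : p ∈ markovStrategies E) (y : E) :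
    ∫⁻ t in Set.Ioo (0 : ℝ) 1, stopIndicator b p y t = stopProb b p y := by
  have h := hp.2 y
  -- With the right endpoint included, the stopping region is exactly `Ioc 0 (p y)`, even for `p y =
  -- 1`.
  rw [setLIntegral_congr (Ioo_ae_eq_Ioc (μ := volume) (a := (0 : ℝ)) (b := 1))]
  cases b
  · have : stopIndicator false p y = (Set.Ioi (p y)).indicator fun _ => 1 := by
      ext t
      simp [stopIndicator, Set.indicator]
    rw [this, lintegral_indicator measurableSet_Ioi, setLIntegral_one,
      Measure.restrict_apply measurableSet_Ioi]
    have : Set.Ioi (p y) ∩ Set.Ioc 0 1 = Set.Ioc (p y) 1 := by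
      ext t
      simp only [Set.mem_inter_iff, Set.mem_Ioi, Set.mem_Ioc]
      constructor
      · tauto
      · exact fun ht => ⟨ht.1, h.1.trans_lt ht.1, ht.2⟩
    rw [this, Real.volume_Ioc]
    simp [stopProb]
  · have : stopIndicator true p y = (Set.Iic (p y)).indicator fun _ => 1 := by
      ext t
      simp [stopIndicator, Set.indicator]
    rw [this, lintegral_indicator measurableSet_Iic, setLIntegral_one,
      Measure.restrict_apply measurableSet_Iic]
    have : Set.Iic (p y) ∩ Set.Ioc 0 1 = Set.Ioc 0 (p y) := by
      ext t
      simp only [Set.mem_inter_iff, Set.mem_Iic, Set.mem_Ioc]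
      constructor
      · tauto
      · exact fun ht => ⟨ht.2, ht.1, ht.2.trans h.2⟩
    rw [this, Real.volume_Ioc]
    simp [stopProb]

/-- The rate at which both players go on, discounted by `α`. -/
noncomputable def continuationRate (α : ℝ) (p q : E → ℝ) (y : E) : ℝ≥0∞ :=
  ENNReal.ofReal α * (stopProb false p y * stopProb false q y)

theorem measurable_continuationRate {p q : E → ℝ} (hp : Measurable p) (hq : Measurable q) :
    Measurable (continuationRate α p q) :=
  ((measurable_stopProb false hp).mul (measurable_stopProb false hq)).const_mul _

theorem IsDynkinSetting.lintegral_stopIndicator_mul [IsMarkovKernel κ]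
    (hset : IsDynkinSetting κ α P X ξ T) (x : E) {p q : E → ℝ} (hp : p ∈ markovStrategies E)
    (hq : q ∈ markovStrategies E) (b b' : Bool) {v : E → ℝ≥0∞} (hv : Measurable v) (n : ℕ) :
    ∫⁻ ω, (∏ k ∈ Finset.range n, ENNReal.ofReal α *
        (stopIndicator false p (X k ω) (ξ 0 k ω) * stopIndicator false q (X k ω) (ξ 1 k ω))) *
        (stopIndicator b p (X n ω) (ξ 0 n ω) * stopIndicator b' q (X n ω) (ξ 1 n ω) * v (X n ω))
        ∂P x =
      (killedOp κ (continuationRate α p q))^[n]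
        (fun y => stopProb b p y * stopProb b' q y * v y) x := by
  have hv' : Measurable fun y => stopProb b p y * stopProb b' q y * v y :=
    ((measurable_stopProb b hp.1).mul (measurable_stopProb b' hq.1)).mul hv
  rw [← hset.process.lintegral_prod_mul x (measurable_continuationRate hp.1 hq.1) hv' n]
  -- All devices up to time `n` form a single product: before `n` both players go on, and at `n`
  -- they act according to `b` and `b'`. The discount factors are moved into `v` as `α ^ n`.
  let ψ : Fin 2 × ℕ → E → ℝ → ℝ≥0∞ := fun j =>
    stopIndicator (if j.2 < n then false else if j.1 = 0 then b else b') (if j.1 = 0 then p else q)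
  have hst : ∀ i : Fin 2, (if i = 0 then p else q) ∈ markovStrategies E := by
    intro i; split_ifs <;> assumption
  have hψ : ∀ j, Measurable (Function.uncurry (ψ j)) := fun j =>
    measurable_stopIndicator _ (hst j.1).1
  have h := hset.lintegral_prod_device x (Finset.univ ×ˢ Finset.range (n + 1)) hψ
    (hv.const_mul (ENNReal.ofReal α ^ n)) n
  have hint : ∀ j y, ∫⁻ t in Set.Ioo (0 : ℝ) 1, ψ j y t =
      stopProb (if j.2 < n then false else if j.1 = 0 then b else b') (if j.1 = 0 then p else q) y :=
    fun j y => lintegral_stopIndicator _ (hst j.1) y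
  simp only [hint, Finset.prod_product_right, Fin.prod_univ_two, Finset.prod_range_succ, ψ,
    lt_self_iff_false, if_false, if_true, one_ne_zero] at h
  have hL : ∀ F : Bool → (E → ℝ) → E → Fin 2 → ℕ → Ω → ℝ≥0∞, ∀ ω,
      (∏ k ∈ Finset.range n, (F (if k < n then false else b) p (X k ω) 0 k ω *
        F (if k < n then false else b') q (X k ω) 1 k ω)) =
      ∏ k ∈ Finset.range n, (F false p (X k ω) 0 k ω * F false q (X k ω) 1 k ω) := by
    intro F ω
    refine Finset.prod_congr rfl fun k hk => ?_
    rw [if_pos (Finset.mem_range.1 hk), if_pos (Finset.mem_range.1 hk)]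
  have h1 := fun ω => hL (fun b p y i k ω => stopIndicator b p y (ξ i k ω)) ω
  have h2 := fun ω => hL (fun b p y i k ω => stopProb b p y) ω
  simp only [h1, h2] at h
  simp only [continuationRate, Finset.prod_mul_distrib, Finset.prod_const, Finset.card_range]
    at h ⊢
  convert h using 3 <;> ring

end Devices

/-! ### Evaluating the stopping times -/

section StoppingTime

variable {E Ω : Type*} {X : ℕ → Ω → E}

theorem markovStoppingTime_eq {ζ : ℕ → Ω → ℝ} {p : E → ℝ} {ω : Ω} {N : ℕ}
    (hlt : ∀ k < N, ¬ ζ k ω ≤ p (X k ω)) (hN : ζ N ω ≤ p (X N ω)) :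
    markovStoppingTime X ζ p ω = N := by
  refine le_antisymm (iInf₂_le N hN) (le_iInf₂ fun k hk => ?_)
  exact_mod_cast not_lt.1 fun h => hlt k h hk

theorem lt_markovStoppingTime {ζ : ℕ → Ω → ℝ} {p : E → ℝ} {ω : Ω} {N : ℕ}
    (hle : ∀ k ≤ N, ¬ ζ k ω ≤ p (X k ω)) : (N : ℕ∞) < markovStoppingTime X ζ p ω := by
  refine lt_of_lt_of_le (b := ((N + 1 : ℕ) : ℕ∞)) (by exact_mod_cast N.lt_succ_self)
    (le_iInf₂ fun k hk => ?_)
  exact_mod_cast not_lt.1 fun h => hle k (Nat.lt_succ_iff.1 h) hk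

theorem markovStoppingTime_eq_top {ζ : ℕ → Ω → ℝ} {p : E → ℝ} {ω : Ω}
    (h : ∀ k, ¬ ζ k ω ≤ p (X k ω)) : markovStoppingTime X ζ p ω = ⊤ :=
  iInf₂_eq_top.2 fun k hk => absurd hk (h k)

end StoppingTime

/-! ### The reward as a sum over time steps -/

section Reward

variable {E Ω : Type*} [MeasurableSpace E] [MeasurableSpace Ω] {κ : Kernel E E} {α : ℝ}
  {P : E → Measure Ω} {X : ℕ → Ω → E} {ξ : Fin 2 → ℕ → Ω → ℝ} {T : Ω → ℕ}

/-- The positive part of the undiscounted reward of player 1 in step `n`, on the event that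
player 1 stops (if `b`) or goes on (if not `b`), and likewise for player 2 and `b'`. -/
noncomputable def stepReward (p q : E → ℝ) (f g h : E → ℝ) (X : ℕ → Ω → E)
    (ξ : Fin 2 → ℕ → Ω → ℝ) (n : ℕ) (ω : Ω) (b b' : Bool) : ℝ≥0∞ :=
  stopIndicator b p (X n ω) (ξ 0 n ω) * stopIndicator b' q (X n ω) (ξ 1 n ω) *
    ENNReal.ofReal ((if b then if b' then h else f else g) (X n ω))

omit [MeasurableSpace E] [MeasurableSpace Ω] in
-- At most one summand is nonzero, at the first time `N` when somebody stops: earlier no stopping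
-- indicator is on, and later the product contains the zero factor of index `N`. This is why taking
-- the positive part commutes with the sum.
theorem ofReal_reward (hα : 0 ≤ α) (f g h p q : E → ℝ) (ω : Ω) :
    ENNReal.ofReal (reward α f g h X (markovStoppingTime X (ξ 0) p)
      (markovStoppingTime X (ξ 1) q) ω) =
    ∑' n, (∏ k ∈ Finset.range n, ENNReal.ofReal α *
        (stopIndicator false p (X k ω) (ξ 0 k ω) * stopIndicator false q (X k ω) (ξ 1 k ω))) *
      (stepReward p q f g h X ξ n ω true false + stepReward p q f g h X ξ n ω false true +
        stepReward p q f g h X ξ n ω true true) := by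
  classical
  by_cases hex : ∃ n, ξ 0 n ω ≤ p (X n ω) ∨ ξ 1 n ω ≤ q (X n ω)
  · obtain ⟨N, hN, hmin⟩ : ∃ N, (ξ 0 N ω ≤ p (X N ω) ∨ ξ 1 N ω ≤ q (X N ω)) ∧
        ∀ k < N, ¬ ξ 0 k ω ≤ p (X k ω) ∧ ¬ ξ 1 k ω ≤ q (X k ω) :=
      ⟨Nat.find hex, Nat.find_spec hex, fun k hk => not_or.1 (Nat.find_min hex hk)⟩
    rw [tsum_eq_single N]
    · have hprod : (∏ k ∈ Finset.range N, ENNReal.ofReal α * (stopIndicator false p (X k ω)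
          (ξ 0 k ω) * stopIndicator false q (X k ω) (ξ 1 k ω))) = ENNReal.ofReal (α ^ N) := by
        rw [ENNReal.ofReal_pow hα]
        refine (Finset.prod_congr rfl fun k hk => ?_).trans (Finset.prod_const _ |>.trans (by rw [Finset.card_range]))
        have := hmin k (Finset.mem_range.1 hk)
        simp [stopIndicator, this.1, this.2]
      rw [hprod]
      have hn0 : ∀ k < N, ¬ ξ 0 k ω ≤ p (X k ω) := fun k hk => (hmin k hk).1
      have hn1 : ∀ k < N, ¬ ξ 1 k ω ≤ q (X k ω) := fun k hk => (hmin k hk).2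
      by_cases h0 : ξ 0 N ω ≤ p (X N ω)
      · have e0 := markovStoppingTime_eq (X := X) hn0 h0
        by_cases h1 : ξ 1 N ω ≤ q (X N ω)
        · have e1 := markovStoppingTime_eq (X := X) hn1 h1
          simp [reward, e0, e1, stepReward, stopIndicator, h0, h1, ENNReal.ofReal_mul,
            pow_nonneg hα]
        · have e1 : (N : ℕ∞) < markovStoppingTime X (ξ 1) q ω :=
            lt_markovStoppingTime fun k hk => hk.lt_or_eq.elim (hn1 k) fun e => e ▸ h1
          simp [reward, e0, e1, stepReward, stopIndicator, h0, h1, ENNReal.ofReal_mul,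
            pow_nonneg hα]
      · have h1 := hN.resolve_left h0
        have e1 := markovStoppingTime_eq (X := X) hn1 h1
        have e0 : (N : ℕ∞) < markovStoppingTime X (ξ 0) p ω :=
          lt_markovStoppingTime fun k hk => hk.lt_or_eq.elim (hn0 k) fun e => e ▸ h0
        simp [reward, e0, e0.not_gt, e1, stepReward, stopIndicator, h0, h1, ENNReal.ofReal_mul,
          pow_nonneg hα]
    · intro n hn
      rcases lt_or_gt_of_ne hn with hlt | hgt
      · have := hmin n hlt
        simp [stepReward, stopIndicator, this.1, this.2]
      · rw [Finset.prod_eq_zero (Finset.mem_range.2 hgt), zero_mul]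
        rcases hN with h0 | h1
        · simp [stopIndicator, h0]
        · simp [stopIndicator, h1]
  · push Not at hex
    have h0 : ∀ k, ¬ ξ 0 k ω ≤ p (X k ω) := fun k => (hex k).1.not_ge
    have h1 : ∀ k, ¬ ξ 1 k ω ≤ q (X k ω) := fun k => (hex k).2.not_ge
    have e0 := markovStoppingTime_eq_top (X := X) h0
    have e1 := markovStoppingTime_eq_top (X := X) h1
    simp [reward, e0, e1, stepReward, stopIndicator, h0, h1]

/-- The expected positive part of the reward that is paid in the current step. -/
noncomputable def immediateReward (p q f g h : E → ℝ) (y : E) : ℝ≥0∞ :=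
  stopProb true p y * stopProb false q y * ENNReal.ofReal (f y) +
    stopProb false p y * stopProb true q y * ENNReal.ofReal (g y) +
    stopProb true p y * stopProb true q y * ENNReal.ofReal (h y)

theorem measurable_immediateReward {p q f g h : E → ℝ} (hp : Measurable p) (hq : Measurable q)
    (hf : Measurable f) (hg : Measurable g) (hh : Measurable h) :
    Measurable (immediateReward p q f g h) := by
  have h1 := fun b => measurable_stopProb b hp
  have h2 := fun b => measurable_stopProb b hq
  exact ((((h1 true).mul (h2 false)).mul hf.ennreal_ofReal).add
    (((h1 false).mul (h2 true)).mul hg.ennreal_ofReal)).add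
    (((h1 true).mul (h2 true)).mul hh.ennreal_ofReal)

theorem IsDynkinSetting.measurable_stopIndicator (hset : IsDynkinSetting κ α P X ξ T) (b : Bool)
    {p : E → ℝ} (hp : Measurable p) (i : Fin 2) (n : ℕ) :
    Measurable fun ω => stopIndicator b p (X n ω) (ξ i n ω) :=
  (_root_.measurable_stopIndicator b hp).comp
    ((hset.process.measurable n).prodMk (hset.measurable_device i n))

theorem IsDynkinSetting.measurable_stepReward (hset : IsDynkinSetting κ α P X ξ T)
    {p q f g h : E → ℝ} (hp : Measurable p) (hq : Measurable q) (hf : Measurable f)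
    (hg : Measurable g) (hh : Measurable h) (n : ℕ) (b b' : Bool) :
    Measurable fun ω => stepReward p q f g h X ξ n ω b b' := by
  refine ((hset.measurable_stopIndicator _ hp _ _).mul
    (hset.measurable_stopIndicator _ hq _ _)).mul (Measurable.ennreal_ofReal ?_)
  refine Measurable.comp ?_ (hset.process.measurable n)
  cases b
  · exact hg
  · cases b'
    · exact hf
    · exact hh

theorem IsDynkinSetting.measurable_prod_stopIndicator (hset : IsDynkinSetting κ α P X ξ T)
    {p q : E → ℝ} (hp : Measurable p) (hq : Measurable q) (n : ℕ) :
    Measurable fun ω => ∏ k ∈ Finset.range n, ENNReal.ofReal α *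
      (stopIndicator false p (X k ω) (ξ 0 k ω) * stopIndicator false q (X k ω) (ξ 1 k ω)) :=
  Finset.measurable_prod _ fun _ _ => ((hset.measurable_stopIndicator _ hp _ _).mul
    (hset.measurable_stopIndicator _ hq _ _)).const_mul _

theorem IsDynkinSetting.measurable_ofReal_reward (hset : IsDynkinSetting κ α P X ξ T) (hα : 0 ≤ α)
    {p q f g h : E → ℝ} (hp : Measurable p) (hq : Measurable q) (hf : Measurable f)
    (hg : Measurable g) (hh : Measurable h) :
    Measurable fun ω => ENNReal.ofReal (reward α f g h X (markovStoppingTime X (ξ 0) p)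
      (markovStoppingTime X (ξ 1) q) ω) := by
  simp only [ofReal_reward hα]
  exact Measurable.tsum fun n => (hset.measurable_prod_stopIndicator hp hq n).mul
    (((hset.measurable_stepReward hp hq hf hg hh _ _ _).add
      (hset.measurable_stepReward hp hq hf hg hh _ _ _)).add
      (hset.measurable_stepReward hp hq hf hg hh _ _ _))

theorem IsDynkinSetting.lintegral_ofReal_reward [IsMarkovKernel κ]
    (hset : IsDynkinSetting κ α P X ξ T) (hα : 0 ≤ α) {p q f g h : E → ℝ}
    (hp : p ∈ markovStrategies E) (hq : q ∈ markovStrategies E) (hf : Measurable f)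
    (hg : Measurable g) (hh : Measurable h) (x : E) :
    ∫⁻ ω, ENNReal.ofReal (reward α f g h X (markovStoppingTime X (ξ 0) p)
      (markovStoppingTime X (ξ 1) q) ω) ∂P x =
    potential κ (continuationRate α p q) (immediateReward p q f g h) x := by
  have hm := hset.measurable_stepReward hp.1 hq.1 hf hg hh
  have hc := measurable_continuationRate (α := α) hp.1 hq.1
  have hD := hset.measurable_prod_stopIndicator hp.1 hq.1
  have h1 := fun b => measurable_stopProb b hp.1
  have h2 := fun b => measurable_stopProb b hq.1
  simp only [ofReal_reward hα]
  rw [lintegral_tsum fun n => ((hD n).fun_mul (((hm _ _ _).fun_add (hm _ _ _)).fun_add (hm _ _ _))).aemeasurable]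
  refine tsum_congr fun n => ?_
  have hstep : ∀ b b', ∫⁻ ω, (∏ k ∈ Finset.range n, ENNReal.ofReal α *
        (stopIndicator false p (X k ω) (ξ 0 k ω) * stopIndicator false q (X k ω) (ξ 1 k ω))) *
        stepReward p q f g h X ξ n ω b b' ∂P x =
      (killedOp κ (continuationRate α p q))^[n] (fun y => stopProb b p y * stopProb b' q y *
        ENNReal.ofReal ((if b then if b' then h else f else g) y)) x := fun b b' =>
    hset.lintegral_stopIndicator_mul x hp hq b b' (Measurable.ennreal_ofReal (by
      cases b
      · exact hg
      · cases b'
        · exact hf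
        · exact hh)) n
  simp only [mul_add]
  rw [lintegral_add_left (((hD n).fun_mul (hm _ _ _)).fun_add ((hD n).fun_mul (hm _ _ _))),
    lintegral_add_left ((hD n).fun_mul (hm _ _ _)), hstep, hstep, hstep]
  unfold immediateReward
  rw [killedOp_iterate_add hc, killedOp_iterate_add hc]
  · rfl
  · exact ((h1 _).fun_mul (h2 _)).fun_mul hf.ennreal_ofReal
  · exact (((h1 _).fun_mul (h2 _)).fun_mul hf.ennreal_ofReal).fun_add
      (((h1 _).fun_mul (h2 _)).fun_mul hg.ennreal_ofReal)

end Reward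

/-! ### Finiteness of the potentials -/

section Integrability

variable {E Ω : Type*} [MeasurableSpace E] [MeasurableSpace Ω] {κ : Kernel E E} {α : ℝ}
  {P : E → Measure Ω} {X : ℕ → Ω → E} {ξ : Fin 2 → ℕ → Ω → ℝ} {T : Ω → ℕ}

/-- Splitting according to the value of `T`, which is independent of the path, produces the weights
`α ^ k * (1 - α)`. -/
theorem IsDynkinSetting.lintegral_enorm_at_lifetime [IsMarkovKernel κ]
    (hset : IsDynkinSetting κ α P X ξ T) (hα₀ : 0 ≤ α) {u : E → ℝ} (hu : Measurable u) (x : E) :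
    ∫⁻ ω, ‖u (X (T ω) ω)‖ₑ ∂P x =
      ENNReal.ofReal (1 - α) * potential κ (fun _ => ENNReal.ofReal α) (fun y => ‖u y‖ₑ) x := by
  have hTk : ∀ k, MeasurableSet {ω | T ω = k} := fun k =>
    hset.measurable_lifetime (measurableSet_singleton k)
  have huX : ∀ k, Measurable fun ω => ‖u (X k ω)‖ₑ := fun k =>
    (hu.comp (hset.process.measurable k)).enorm
  have hsum : ∀ ω, ‖u (X (T ω) ω)‖ₑ =
      ∑' k, {ω | T ω = k}.indicator (fun _ => 1) ω * ‖u (X k ω)‖ₑ := by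
    intro ω
    rw [tsum_eq_single (T ω)]
    · simp
    · intro k hk
      simp [hk.symm]
  simp only [hsum]
  rw [lintegral_tsum fun k => ((measurable_const.indicator (hTk k)).fun_mul (huX k)).aemeasurable,
    potential, ← ENNReal.tsum_mul_left]
  refine tsum_congr fun k => ?_
  have hind : IndepFun (fun ω => {ω | T ω = k}.indicator (fun _ => (1 : ℝ≥0∞)) ω)
      (fun ω => ‖u (X k ω)‖ₑ) (P x) := by
    have h := (hset.indepFun_process x).comp (φ := fun z : ℕ → E => ‖u (z k)‖ₑ)
      (ψ := fun z : (Fin 2 → ℕ → ℝ) × ℕ => ({k} : Set ℕ).indicator (fun _ => (1 : ℝ≥0∞)) z.2)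
      (by fun_prop) ((measurable_of_countable
        (({k} : Set ℕ).indicator (fun _ => (1 : ℝ≥0∞)))).comp measurable_snd)
    exact h.symm
  rw [lintegral_mul_eq_lintegral_mul_lintegral_of_indepFun''
      (measurable_const.indicator (hTk k)).aemeasurable (huX k).aemeasurable hind,
    lintegral_indicator (hTk k), setLIntegral_one, hset.geometric_lifetime,
    ← hset.process.lintegral_prod_mul x measurable_const hu.enorm k]
  simp only [Finset.prod_const, Finset.card_range]
  rw [lintegral_const_mul _ (huX k), ENNReal.ofReal_mul (pow_nonneg hα₀ k),
    ENNReal.ofReal_pow hα₀, ← mul_assoc, mul_comm (ENNReal.ofReal α ^ k)]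

/-- The process is still alive at time `T`, so the supremum dominates the payoff there; the factor
`1 - α` is positive and can be cancelled. -/
theorem IsDynkinSetting.potential_enorm_ne_top [IsMarkovKernel κ]
    (hset : IsDynkinSetting κ α P X ξ T) (hα₀ : 0 ≤ α) (hα₁ : α < 1) {u : E → ℝ}
    (hu : Measurable u) (hui : IntegrableSupKilled P X T u) (x : E) :
    potential κ (fun _ => ENNReal.ofReal α) (fun y => ‖u y‖ₑ) x ≠ ∞ := by
  have hle : ∫⁻ ω, ‖u (X (T ω) ω)‖ₑ ∂P x ≤
      ∫⁻ ω, ⨆ n : ℕ, ‖extendByZero u (killedProcess X T n ω)‖ₑ ∂(P x) := by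
    refine lintegral_mono fun ω => ?_
    refine le_trans (le_of_eq ?_)
      (le_iSup (fun n => ‖extendByZero u (killedProcess X T n ω)‖ₑ) (T ω))
    simp [killedProcess, extendByZero]
  have hfin := hle.trans_lt (hui x)
  rw [hset.lintegral_enorm_at_lifetime hα₀ hu] at hfin
  intro htop
  rw [htop, ENNReal.mul_top (by simpa using hα₁)] at hfin
  exact lt_irrefl _ hfin

end Integrability

/-! ### Comparison principle and Bellman equation -/

section Bellman

variable {E : Type*} [MeasurableSpace E] {κ : Kernel E E} {α : ℝ}

/-- The expected absolute value of all the rewards that could be collected, discounted by `α`. -/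
noncomputable def totalPotential (κ : Kernel E E) (α : ℝ) (f g h : E → ℝ) : E → ℝ≥0∞ :=
  potential κ (fun _ => ENNReal.ofReal α) (fun y => ‖f y‖ₑ + (‖g y‖ₑ + ‖h y‖ₑ))

theorem measurable_totalPotential {f g h : E → ℝ} (hf : Measurable f) (hg : Measurable g)
    (hh : Measurable h) : Measurable (totalPotential κ α f g h) :=
  measurable_potential measurable_const (by fun_prop)

theorem totalPotential_eq {f g h : E → ℝ} (hf : Measurable f) (hg : Measurable g)
    (hh : Measurable h) (x : E) :
    totalPotential κ α f g h x = ‖f x‖ₑ + (‖g x‖ₑ + ‖h x‖ₑ) +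
      ENNReal.ofReal α * ∫⁻ y, totalPotential κ α f g h y ∂κ x :=
  potential_eq measurable_const (by fun_prop) x

section Finite

variable {f g h : E → ℝ} (hα : 0 < α) (hf : Measurable f) (hg : Measurable g) (hh : Measurable h)
  (hW : ∀ x, totalPotential κ α f g h x ≠ ∞)

include hα hf hg hh hW

theorem lintegral_totalPotential_ne_top (x : E) :
    ∫⁻ y, totalPotential κ α f g h y ∂κ x ≠ ∞ := by
  intro htop
  refine hW x ?_
  rw [totalPotential_eq hf hg hh, htop, ENNReal.mul_top (by simpa using hα), add_top]

theorem integrable_toReal_totalPotential (x : E) :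
    Integrable (fun y => (totalPotential κ α f g h y).toReal) (κ x) :=
  integrable_toReal_of_lintegral_ne_top (measurable_totalPotential hf hg hh).aemeasurable
    (lintegral_totalPotential_ne_top hα hf hg hh hW x)

theorem toReal_totalPotential_eq (x : E) :
    (totalPotential κ α f g h x).toReal = |f x| + |g x| + |h x| +
      α * ∫ y, (totalPotential κ α f g h y).toReal ∂κ x := by
  have h1 := lintegral_totalPotential_ne_top hα hf hg hh hW x
  rw [integral_toReal (measurable_totalPotential hf hg hh).aemeasurable
      (ae_lt_top (measurable_totalPotential hf hg hh) h1),
    totalPotential_eq hf hg hh, ENNReal.toReal_add (by simp) (ENNReal.mul_ne_top (by simp) h1),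
    ENNReal.toReal_add (by simp) (by simp), ENNReal.toReal_add (by simp) (by simp),
    ENNReal.toReal_mul, ENNReal.toReal_ofReal hα.le]
  simp [add_assoc]

theorem integrable_of_abs_le_totalPotential {v : E → ℝ} (hv : Measurable v)
    (hvW : ∀ x, |v x| ≤ (totalPotential κ α f g h x).toReal) (x : E) : Integrable v (κ x) :=
  (integrable_toReal_totalPotential hα hf hg hh hW x).mono' hv.aestronglyMeasurable
    (Filter.Eventually.of_forall hvW)

/-- Comparison principle. -/
theorem le_of_sub_le_mul_integral {u v c : E → ℝ} (hu : Measurable u) (hv : Measurable v)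
    (huW : ∀ x, |u x| ≤ (totalPotential κ α f g h x).toReal)
    (hvW : ∀ x, |v x| ≤ (totalPotential κ α f g h x).toReal)
    (hc : ∀ x, c x ∈ Set.Icc (0 : ℝ) 1)
    (huv : ∀ x, u x - v x ≤ c x * (α * ∫ y, (u y - v y) ∂κ x)) : u ≤ v := by
  have hint : ∀ x, Integrable (fun y => u y - v y) (κ x) := fun x =>
    (integrable_of_abs_le_totalPotential hα hf hg hh hW hu huW x).sub
      (integrable_of_abs_le_totalPotential hα hf hg hh hW hv hvW x)
  -- The positive part of `u - v` is a subsolution, since `c ≤ 1` may be dropped once the integrand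
  -- is nonnegative. The constant `2` comes from bounding `u` and `v` separately by the total
  -- potential.
  have h0 : (fun x => ENNReal.ofReal (u x - v x)) = 0 := by
    refine eq_zero_of_le_killedOp (κ := κ) (c := fun _ => ENNReal.ofReal α)
      (v := fun y => ‖f y‖ₑ + (‖g y‖ₑ + ‖h y‖ₑ)) measurable_const (by fun_prop) hW
      (b := 2) (by simp) (fun x => ?_) (fun x => ?_)
    · have hpos := (hint x).pos_part
      have hle : ∫ y, (u y - v y) ∂κ x ≤ ∫ y, max (u y - v y) 0 ∂κ x :=
        integral_mono (hint x) hpos fun y => le_max_left _ _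
      have hnn : 0 ≤ α * ∫ y, max (u y - v y) 0 ∂κ x :=
        mul_nonneg hα.le (integral_nonneg fun y => le_max_right _ _)
      have hmain : u x - v x ≤ α * ∫ y, max (u y - v y) 0 ∂κ x :=
        calc u x - v x ≤ c x * (α * ∫ y, (u y - v y) ∂κ x) := huv x
          _ ≤ c x * (α * ∫ y, max (u y - v y) 0 ∂κ x) :=
            mul_le_mul_of_nonneg_left (mul_le_mul_of_nonneg_left hle hα.le) (hc x).1
          _ ≤ _ := mul_le_of_le_one_left hnn (hc x).2
      refine (ENNReal.ofReal_le_ofReal hmain).trans (le_of_eq ?_)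
      rw [ENNReal.ofReal_mul hα.le, ofReal_integral_eq_lintegral_ofReal hpos
        (Filter.Eventually.of_forall fun y => le_max_right _ _)]
      simp [killedOp, ENNReal.ofReal_max]
    · have : u x - v x ≤ 2 * (totalPotential κ α f g h x).toReal := by
        linarith [le_abs_self (u x), neg_abs_le (v x), huW x, hvW x]
      refine (ENNReal.ofReal_le_ofReal this).trans (le_of_eq ?_)
      rw [ENNReal.ofReal_mul zero_le_two, ENNReal.ofReal_toReal (hW x)]
      simp [totalPotential]
  intro x
  have := congrFun h0 x
  simpa using this

end Finite

/-- The value of stopping for player 1, if player 2 stops with probability `q`. -/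
def stopValue (q f h : E → ℝ) (x : E) : ℝ := (1 - q x) * f x + q x * h x

/-- The value of going on for player 1, if player 2 stops with probability `q` and `v` is the
value of the game in the next step. -/
noncomputable def continuationValue (κ : Kernel E E) (α : ℝ) (q g v : E → ℝ) (x : E) : ℝ :=
  q x * g x + (1 - q x) * (α * ∫ y, v y ∂κ x)

theorem measurable_stopValue {q f h : E → ℝ} (hq : Measurable q) (hf : Measurable f)
    (hh : Measurable h) : Measurable (stopValue q f h) := by
  unfold stopValue
  fun_prop

theorem measurable_continuationValue [IsMarkovKernel κ] {q g v : E → ℝ} (hq : Measurable q)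
    (hg : Measurable g) (hv : Measurable v) : Measurable (continuationValue κ α q g v) := by
  have : Measurable fun x => ∫ y, v y ∂κ x := hv.stronglyMeasurable.integral_kernel.measurable
  unfold continuationValue
  fun_prop

section ValueIteration

variable {f g h : E → ℝ} (hα : 0 < α) (hf : Measurable f) (hg : Measurable g) (hh : Measurable h)
  (hW : ∀ x, totalPotential κ α f g h x ≠ ∞) {q : E → ℝ} (hq : q ∈ markovStrategies E)

include hα hf hg hh hW hq

theorem abs_stopValue_le (x : E) :
    |stopValue q f h x| ≤ (totalPotential κ α f g h x).toReal := by
  have hq0 := (hq.2 x).1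
  have hq1 := (hq.2 x).2
  rw [toReal_totalPotential_eq hα hf hg hh hW]
  have h0 : 0 ≤ α * ∫ y, (totalPotential κ α f g h y).toReal ∂κ x :=
    mul_nonneg hα.le (integral_nonneg fun y => ENNReal.toReal_nonneg)
  have h1 : |(1 - q x) * f x| ≤ |f x| := by
    rw [abs_mul, abs_of_nonneg (by linarith)]
    exact mul_le_of_le_one_left (abs_nonneg _) (by linarith)
  have h2 : |q x * h x| ≤ |h x| := by
    rw [abs_mul, abs_of_nonneg hq0]
    exact mul_le_of_le_one_left (abs_nonneg _) hq1
  unfold stopValue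
  linarith [abs_add_le ((1 - q x) * f x) (q x * h x), abs_nonneg (g x)]

/-- The one-step equation for the total potential pays for the current payoff and the discounted
future separately, so value iteration preserves this bound. -/
theorem abs_continuationValue_le {v : E → ℝ}
    (hvW : ∀ x, |v x| ≤ (totalPotential κ α f g h x).toReal) (x : E) :
    |continuationValue κ α q g v x| ≤ (totalPotential κ α f g h x).toReal := by
  have hq0 := (hq.2 x).1
  have hq1 := (hq.2 x).2
  rw [toReal_totalPotential_eq hα hf hg hh hW]
  have h1 : |q x * g x| ≤ |g x| := by
    rw [abs_mul, abs_of_nonneg hq0]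
    exact mul_le_of_le_one_left (abs_nonneg _) hq1
  have h2 : |(1 - q x) * (α * ∫ y, v y ∂κ x)| ≤
      α * ∫ y, (totalPotential κ α f g h y).toReal ∂κ x := by
    rw [abs_mul, abs_mul, abs_of_nonneg (show 0 ≤ 1 - q x by linarith), abs_of_pos hα]
    refine (mul_le_of_le_one_left (by positivity) (by linarith)).trans
      (mul_le_mul_of_nonneg_left ?_ hα.le)
    exact norm_integral_le_of_norm_le (integrable_toReal_totalPotential hα hf hg hh hW x)
      (Filter.Eventually.of_forall fun y => (Real.norm_eq_abs _).trans_le (hvW y))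
  unfold continuationValue
  linarith [abs_add_le (q x * g x) ((1 - q x) * (α * ∫ y, v y ∂κ x)), abs_nonneg (f x),
    abs_nonneg (h x)]

/-- The Bellman equation has a measurable solution that is dominated by the total potential. -/
theorem exists_value [IsMarkovKernel κ] : ∃ V : E → ℝ, Measurable V ∧
    (∀ x, |V x| ≤ (totalPotential κ α f g h x).toReal) ∧
    ∀ x, V x = max (stopValue q f h x) (continuationValue κ α q g V x) := by
  set w : E → ℝ := fun x => (totalPotential κ α f g h x).toReal with hw
  have hwm : Measurable w := (measurable_totalPotential hf hg hh).ennreal_toReal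
  let Φ : (E → ℝ) → E → ℝ := fun v x =>
    max (stopValue q f h x) (continuationValue κ α q g v x)
  -- The iteration starts at the supersolution `w`, so it decreases by monotonicity of `Φ`; it stays
  -- above `-w`, hence converges pointwise.
  let V : ℕ → E → ℝ := fun n => Φ^[n] w
  have hV : ∀ n, V (n + 1) = Φ (V n) := fun n => Function.iterate_succ_apply' Φ n w
  have hVm : ∀ n, Measurable (V n) := by
    intro n
    induction n with
    | zero => exact hwm
    | succ n ih =>
      rw [hV]
      exact (measurable_stopValue hq.1 hf hh).max (measurable_continuationValue hq.1 hg ih)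
  have hΦw : ∀ v : E → ℝ, (∀ x, |v x| ≤ w x) → ∀ x, |Φ v x| ≤ w x := fun v hv x =>
    abs_max_le_max_abs_abs.trans (max_le (abs_stopValue_le hα hf hg hh hW hq x)
      (abs_continuationValue_le hα hf hg hh hW hq hv x))
  have hVw : ∀ n x, |V n x| ≤ w x := by
    intro n
    induction n with
    | zero => exact fun x => (abs_of_nonneg ENNReal.toReal_nonneg).le
    | succ n ih =>
      rw [hV]
      exact hΦw _ ih
  have hint : ∀ n x, Integrable (V n) (κ x) := fun n x =>
    integrable_of_abs_le_totalPotential hα hf hg hh hW (hVm n) (hVw n) x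
  have hstep : ∀ n, V (n + 1) ≤ V n := by
    intro n
    induction n with
    | zero => exact fun x => (le_abs_self _).trans (hVw 1 x)
    | succ n ih =>
      intro x
      rw [hV (n + 1)]
      nth_rw 2 [hV n]
      refine max_le_max le_rfl (add_le_add le_rfl ?_)
      exact mul_le_mul_of_nonneg_left (mul_le_mul_of_nonneg_left
        (integral_mono (hint _ x) (hint _ x) ih) hα.le) (by linarith [(hq.2 x).2])
  have hlim : ∀ x, Filter.Tendsto (fun n => V n x) Filter.atTop (nhds (⨅ n, V n x)) := fun x =>
    tendsto_atTop_ciInf (antitone_nat_of_succ_le fun n => hstep n x)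
      ⟨-w x, by rintro _ ⟨n, rfl⟩; exact (abs_le.1 (hVw n x)).1⟩
  refine ⟨fun x => ⨅ n, V n x, measurable_of_tendsto_metrizable hVm (tendsto_pi_nhds.2 hlim),
    fun x => le_of_tendsto' (hlim x).abs fun n => hVw n x, fun x => ?_⟩
  -- Dominated convergence with majorant `w` lets the limit pass through the kernel.
  have hI : Filter.Tendsto (fun n => ∫ y, V n y ∂κ x) Filter.atTop
      (nhds (∫ y, ⨅ n, V n y ∂κ x)) :=
    tendsto_integral_of_dominated_convergence w (fun n => (hVm n).aestronglyMeasurable)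
      (integrable_toReal_totalPotential hα hf hg hh hW x)
      (fun n => Filter.Eventually.of_forall (hVw n)) (Filter.Eventually.of_forall hlim)
  have h1 := (hlim x).comp (Filter.tendsto_add_atTop_nat 1)
  have h2 : Filter.Tendsto (fun n => V (n + 1) x) Filter.atTop (nhds
      (max (stopValue q f h x) (continuationValue κ α q g (fun x => ⨅ n, V n x) x))) := by
    simp only [hV]
    exact tendsto_const_nhds.max (tendsto_const_nhds.add ((hI.const_mul α).const_mul _))
  exact tendsto_nhds_unique h1 h2

end ValueIteration

end Bellman

/-! ### The expected reward as a function of the initial state -/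

theorem reward_neg {E Ω : Type*} {α : ℝ} {X : ℕ → Ω → E} (f g h : E → ℝ) (τ₁ τ₂ : Ω → ℕ∞) (ω : Ω) :
    reward α (-f) (-g) (-h) X τ₁ τ₂ ω = -reward α f g h X τ₁ τ₂ ω := by
  unfold reward
  split_ifs <;> simp

section ExpectedReward

variable {E Ω : Type*} [MeasurableSpace E] [MeasurableSpace Ω] {κ : Kernel E E} {α : ℝ}
  {P : E → Measure Ω} {X : ℕ → Ω → E} {ξ : Fin 2 → ℕ → Ω → ℝ} {T : Ω → ℕ}

theorem immediateReward_le {p q f g h : E → ℝ} (hp : p ∈ markovStrategies E)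
    (hq : q ∈ markovStrategies E) :
    immediateReward p q f g h ≤ fun y => ‖f y‖ₑ + (‖g y‖ₑ + ‖h y‖ₑ) := by
  intro y
  have h1 : ∀ b b' r, stopProb b p y * stopProb b' q y * ENNReal.ofReal r ≤ ‖r‖ₑ := fun b b' r =>
    (mul_le_mul' (mul_le_one' (stopProb_le_one b hp y) (stopProb_le_one b' hq y))
      (Real.ofReal_le_enorm r)).trans (one_mul _).le
  unfold immediateReward
  rw [add_assoc]
  exact add_le_add (h1 _ _ _) (add_le_add (h1 _ _ _) (h1 _ _ _))

theorem toReal_immediateReward {p q f g h : E → ℝ} (hp : p ∈ markovStrategies E)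
    (hq : q ∈ markovStrategies E) (y : E) :
    (immediateReward p q f g h y).toReal =
      p y * (1 - q y) * max (f y) 0 + (1 - p y) * q y * max (g y) 0 +
        p y * q y * max (h y) 0 := by
  have hp0 := (hp.2 y).1
  have hp1 := (hp.2 y).2
  have hq0 := (hq.2 y).1
  have hq1 := (hq.2 y).2
  have hfin : ∀ b b' r, stopProb b p y * stopProb b' q y * ENNReal.ofReal r ≠ ∞ :=
    fun b b' r => ENNReal.mul_ne_top
      (ENNReal.mul_ne_top ENNReal.ofReal_ne_top ENNReal.ofReal_ne_top) ENNReal.ofReal_ne_top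
  unfold immediateReward
  rw [ENNReal.toReal_add (ENNReal.add_ne_top.2 ⟨hfin _ _ _, hfin _ _ _⟩) (hfin _ _ _),
    ENNReal.toReal_add (hfin _ _ _) (hfin _ _ _)]
  simp [ENNReal.toReal_mul, stopProb, ENNReal.toReal_ofReal', hp0, hp1, hq0, hq1]

theorem toReal_continuationRate (hα : 0 ≤ α) {p q : E → ℝ} (hp : p ∈ markovStrategies E)
    (hq : q ∈ markovStrategies E) (y : E) :
    (continuationRate α p q y).toReal = α * ((1 - p y) * (1 - q y)) := by
  simp [continuationRate, stopProb, ENNReal.toReal_mul, hα, (hp.2 y).2, (hq.2 y).2]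

/-- The separate payoffs `f'`, `g'`, `h'` allow the same bound to serve for the negated payoffs,
which describe the negative part of the reward. -/
theorem potential_continuationRate_le {p q f g h f' g' h' : E → ℝ} (hp : p ∈ markovStrategies E)
    (hq : q ∈ markovStrategies E)
    (hle : (fun y => ‖f' y‖ₑ + (‖g' y‖ₑ + ‖h' y‖ₑ)) ≤ fun y => ‖f y‖ₑ + (‖g y‖ₑ + ‖h y‖ₑ)) :
    potential κ (continuationRate α p q) (immediateReward p q f' g' h') ≤
      totalPotential κ α f g h := by
  refine potential_mono (fun y => ?_) ((immediateReward_le hp hq).trans hle)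
  exact (mul_le_mul' le_rfl (mul_le_one' (stopProb_le_one _ hp y)
    (stopProb_le_one _ hq y))).trans (mul_one _).le

/-- The expected reward of player 1 as a function of the initial state. -/
noncomputable def markovReward (κ : Kernel E E) (α : ℝ) (p q f g h : E → ℝ) (x : E) : ℝ :=
  (potential κ (continuationRate α p q) (immediateReward p q f g h) x).toReal -
    (potential κ (continuationRate α p q) (immediateReward p q (-f) (-g) (-h)) x).toReal

theorem measurable_markovReward {p q f g h : E → ℝ} (hp : Measurable p) (hq : Measurable q)
    (hf : Measurable f) (hg : Measurable g) (hh : Measurable h) :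
    Measurable (markovReward κ α p q f g h) := by
  have hc := measurable_continuationRate (α := α) hp hq
  exact (measurable_potential hc (measurable_immediateReward hp hq hf hg hh)).ennreal_toReal.sub
    (measurable_potential hc
      (measurable_immediateReward hp hq hf.neg hg.neg hh.neg)).ennreal_toReal

theorem abs_markovReward_le {p q f g h : E → ℝ} (hp : p ∈ markovStrategies E)
    (hq : q ∈ markovStrategies E) (hW : ∀ x, totalPotential κ α f g h x ≠ ∞) (x : E) :
    |markovReward κ α p q f g h x| ≤ (totalPotential κ α f g h x).toReal := by
  have h1 := ENNReal.toReal_mono (hW x)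
    (potential_continuationRate_le (κ := κ) (α := α) hp hq le_rfl x)
  have h2 := ENNReal.toReal_mono (hW x) (potential_continuationRate_le (κ := κ) (α := α)
    (f' := -f) (g' := -g) (h' := -h) hp hq (by simp) x)
  exact abs_sub_le_of_nonneg_of_le ENNReal.toReal_nonneg h1 ENNReal.toReal_nonneg h2

theorem IsDynkinSetting.expectedReward_eq [IsMarkovKernel κ]
    (hset : IsDynkinSetting κ α P X ξ T) (hα : 0 ≤ α) {p q f g h : E → ℝ}
    (hp : p ∈ markovStrategies E) (hq : q ∈ markovStrategies E) (hf : Measurable f)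
    (hg : Measurable g) (hh : Measurable h) (hW : ∀ x, totalPotential κ α f g h x ≠ ∞) (x : E) :
    expectedReward α f g h P X x (markovStoppingTime X (ξ 0) p) (markovStoppingTime X (ξ 1) q) =
      markovReward κ α p q f g h x := by
  set R : Ω → ℝ :=
    reward α f g h X (markovStoppingTime X (ξ 0) p) (markovStoppingTime X (ξ 1) q) with hR
  have hm1 : Measurable fun ω => ENNReal.ofReal (R ω) :=
    hset.measurable_ofReal_reward hα hp.1 hq.1 hf hg hh
  have hm2 : Measurable fun ω => ENNReal.ofReal (-R ω) := by
    simpa only [reward_neg] using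
      hset.measurable_ofReal_reward hα hp.1 hq.1 hf.neg hg.neg hh.neg
  have hi1 : ∫⁻ ω, ENNReal.ofReal (R ω) ∂P x = _ :=
    hset.lintegral_ofReal_reward hα hp hq hf hg hh x
  have hi2 : ∫⁻ ω, ENNReal.ofReal (-R ω) ∂P x =
      potential κ (continuationRate α p q) (immediateReward p q (-f) (-g) (-h)) x := by
    simpa only [reward_neg] using
      hset.lintegral_ofReal_reward hα hp hq hf.neg hg.neg hh.neg x
  have hRm : Measurable R := by
    have : R = fun ω => (ENNReal.ofReal (R ω)).toReal - (ENNReal.ofReal (-R ω)).toReal := by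
      ext ω
      rw [ENNReal.toReal_ofReal', ENNReal.toReal_ofReal', max_zero_sub_max_neg_zero_eq_self]
    rw [this]
    exact hm1.ennreal_toReal.sub hm2.ennreal_toReal
  have hRi : Integrable R (P x) := by
    refine ⟨hRm.aestronglyMeasurable, ?_⟩
    have hnorm : ∀ ω, ‖R ω‖ₑ ≤ ENNReal.ofReal (R ω) + ENNReal.ofReal (-R ω) := by
      intro ω
      rw [Real.enorm_eq_ofReal_abs, abs_eq_max_neg, ENNReal.ofReal_max]
      exact max_le le_self_add le_add_self
    refine (lintegral_mono hnorm).trans_lt ?_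
    rw [lintegral_add_left hm1, hi1, hi2]
    exact ENNReal.add_lt_top.2
      ⟨(potential_continuationRate_le hp hq le_rfl x).trans_lt (hW x).lt_top,
      (potential_continuationRate_le hp hq (by simp) x).trans_lt (hW x).lt_top⟩
  unfold expectedReward
  rw [← hR, integral_eq_lintegral_pos_part_sub_lintegral_neg_part hRi, hi1, hi2, markovReward]

theorem toReal_potential_continuationRate {p q f g h f' g' h' : E → ℝ} (hα : 0 < α)
    (hp : p ∈ markovStrategies E) (hq : q ∈ markovStrategies E) (hf : Measurable f)
    (hg : Measurable g) (hh : Measurable h) (hf' : Measurable f')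
    (hg' : Measurable g') (hh' : Measurable h') (hW : ∀ x, totalPotential κ α f g h x ≠ ∞)
    (hle : (fun y => ‖f' y‖ₑ + (‖g' y‖ₑ + ‖h' y‖ₑ)) ≤ fun y => ‖f y‖ₑ + (‖g y‖ₑ + ‖h y‖ₑ))
    (x : E) :
    Integrable (fun y => (potential κ (continuationRate α p q)
      (immediateReward p q f' g' h') y).toReal) (κ x) ∧
    (potential κ (continuationRate α p q) (immediateReward p q f' g' h') x).toReal =
      p x * (1 - q x) * max (f' x) 0 + (1 - p x) * q x * max (g' x) 0 + p x * q x * max (h' x) 0 +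
      α * ((1 - p x) * (1 - q x)) * ∫ y, (potential κ (continuationRate α p q)
        (immediateReward p q f' g' h') y).toReal ∂κ x := by
  have hle' := potential_continuationRate_le (κ := κ) (α := α) hp hq hle
  have hr := measurable_immediateReward hp.1 hq.1 hf' hg' hh'
  have hc := measurable_continuationRate (α := α) hp.1 hq.1
  have hm := measurable_potential (κ := κ) hc hr
  have hfin : ∫⁻ y, potential κ (continuationRate α p q)
      (immediateReward p q f' g' h') y ∂κ x ≠ ∞ :=
    ((lintegral_mono hle').trans_lt
      (lintegral_totalPotential_ne_top hα hf hg hh hW x).lt_top).ne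
  refine ⟨integrable_toReal_of_lintegral_ne_top hm.aemeasurable hfin, ?_⟩
  have hr' : immediateReward p q f' g' h' x ≠ ∞ :=
    ((immediateReward_le hp hq x).trans_lt (by simp)).ne
  have hc' : continuationRate α p q x ≠ ∞ := by simp [continuationRate, stopProb, ENNReal.mul_eq_top]
  rw [integral_toReal hm.aemeasurable (ae_lt_top hm hfin), potential_eq hc hr,
    ENNReal.toReal_add hr' (ENNReal.mul_ne_top hc' hfin), ENNReal.toReal_mul,
    toReal_immediateReward hp hq, toReal_continuationRate hα.le hp hq]

/-- First-step analysis: the one-step equations of the positive and negative parts are subtracted,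
and the payoffs are reassembled from their parts. -/
theorem markovReward_eq {p q f g h : E → ℝ} (hα : 0 < α) (hp : p ∈ markovStrategies E)
    (hq : q ∈ markovStrategies E) (hf : Measurable f) (hg : Measurable g) (hh : Measurable h)
    (hW : ∀ x, totalPotential κ α f g h x ≠ ∞) (x : E) :
    markovReward κ α p q f g h x = p x * stopValue q f h x +
      (1 - p x) * continuationValue κ α q g (markovReward κ α p q f g h) x := by
  obtain ⟨i1, e1⟩ := toReal_potential_continuationRate (κ := κ) hα hp hq hf hg hh hf hg hh hW
    le_rfl x
  obtain ⟨i2, e2⟩ := toReal_potential_continuationRate (κ := κ) hα hp hq hf hg hh hf.neg hg.neg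
    hh.neg hW (by simp) x
  unfold continuationValue
  simp only [markovReward]
  rw [integral_sub i1 i2, e1, e2, stopValue]
  simp only [Pi.neg_apply]
  linear_combination p x * (1 - q x) * max_zero_sub_max_neg_zero_eq_self (f x) +
    (1 - p x) * q x * max_zero_sub_max_neg_zero_eq_self (g x) +
    p x * q x * max_zero_sub_max_neg_zero_eq_self (h x)

end ExpectedReward

/-! ### Greedy strategies and best responses -/

theorem exists_greedy {E : Type*} [MeasurableSpace E] {A B : E → ℝ} (hA : Measurable A) (hB : Measurable B) :
    ∃ p ∈ markovStrategies E, ∀ x, p x * A x + (1 - p x) * B x = max (A x) (B x) := by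
  classical
  refine ⟨fun x => if B x ≤ A x then 1 else 0, ⟨Measurable.ite (measurableSet_le hB hA)
    measurable_const measurable_const, fun x => ?_⟩, fun x => ?_⟩
  · dsimp only
    split_ifs <;> simp
  · dsimp only
    split_ifs with hx
    · simp [hx]
    · simp [(not_le.1 hx).le]

section BestResponse

variable {E Ω : Type*} [MeasurableSpace E] [MeasurableSpace Ω] {κ : Kernel E E} [IsMarkovKernel κ]
  {α : ℝ} {P : E → Measure Ω} {X : ℕ → Ω → E} {ξ : Fin 2 → ℕ → Ω → ℝ} {T : Ω → ℕ}

omit [IsMarkovKernel κ] in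
theorem continuationValue_sub {f g h q u v : E → ℝ} (hα : 0 < α) (hf : Measurable f)
    (hg : Measurable g) (hh : Measurable h) (hW : ∀ x, totalPotential κ α f g h x ≠ ∞)
    (hu : Measurable u) (hv : Measurable v)
    (huW : ∀ x, |u x| ≤ (totalPotential κ α f g h x).toReal)
    (hvW : ∀ x, |v x| ≤ (totalPotential κ α f g h x).toReal) (x : E) :
    continuationValue κ α q g u x - continuationValue κ α q g v x =
      (1 - q x) * (α * ∫ y, (u y - v y) ∂κ x) := by
  rw [integral_sub (integrable_of_abs_le_totalPotential hα hf hg hh hW hu huW x)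
    (integrable_of_abs_le_totalPotential hα hf hg hh hW hv hvW x)]
  unfold continuationValue
  ring

/-- The best responses are the strategies that are greedy with respect to the value function. -/
theorem IsDynkinSetting.exists_bestResponse_eq (hset : IsDynkinSetting κ α P X ξ T) (hα : 0 < α)
    {q f g h : E → ℝ} (hq : q ∈ markovStrategies E) (hf : Measurable f) (hg : Measurable g)
    (hh : Measurable h) (hW : ∀ x, totalPotential κ α f g h x ≠ ∞) :
    ∃ A B : E → ℝ, Measurable A ∧ Measurable B ∧ bestResponse α f g h P X ξ q =
      {p ∈ markovStrategies E | ∀ x, p x * A x + (1 - p x) * B x = max (A x) (B x)} := by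
  obtain ⟨V, hVm, hVW, hV⟩ := exists_value hα hf hg hh hW hq
  set A := stopValue q f h with hA
  set B := continuationValue κ α q g V with hB
  have hAm : Measurable A := measurable_stopValue hq.1 hf hh
  have hBm : Measurable B := measurable_continuationValue hq.1 hg hVm
  have hJm := fun p (hp : p ∈ markovStrategies E) =>
    measurable_markovReward (κ := κ) (α := α) hp.1 hq.1 hf hg hh
  have hJW := fun p (hp : p ∈ markovStrategies E) => abs_markovReward_le hp hq hW
  have hrate : ∀ p ∈ markovStrategies E, ∀ x, (1 - p x) * (1 - q x) ∈ Set.Icc (0 : ℝ) 1 := by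
    intro p hp x
    have hp' := hp.2 x
    have hq' := hq.2 x
    exact ⟨mul_nonneg (by linarith [hp'.2]) (by linarith [hq'.2]),
      mul_le_one₀ (by linarith [hp'.1]) (by linarith [hq'.2]) (by linarith [hq'.1])⟩
  -- Since `V` dominates both `A` and `B`, the difference of reward and `V` is at most `(1 - p) (1 -
  -- q) α` times its own integral, and comparison applies.
  have hle : ∀ p ∈ markovStrategies E, markovReward κ α p q f g h ≤ V := by
    intro p hp
    refine le_of_sub_le_mul_integral hα hf hg hh hW (hJm p hp) hVm (hJW p hp) hVW (hrate p hp)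
      fun x => ?_
    have hsub := continuationValue_sub (q := q) hα hf hg hh hW (hJm p hp) hVm (hJW p hp) hVW x
    have hp' := hp.2 x
    have h1 : p x * A x ≤ p x * V x := mul_le_mul_of_nonneg_left
      ((le_max_left _ _).trans (hV x).ge) hp'.1
    have h2 : (1 - p x) * B x ≤ (1 - p x) * V x := mul_le_mul_of_nonneg_left
      ((le_max_right _ _).trans (hV x).ge) (by linarith [hp'.2])
    rw [mul_assoc, ← hsub, markovReward_eq hα hp hq hf hg hh hW]
    linarith
  have hiff : ∀ p ∈ markovStrategies E, (markovReward κ α p q f g h = V ↔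
      ∀ x, p x * A x + (1 - p x) * B x = max (A x) (B x)) := by
    intro p hp
    constructor
    · intro h x
      have := markovReward_eq (κ := κ) hα hp hq hf hg hh hW x
      rw [h] at this
      rw [← hV x, this]
    · intro h
      -- For a greedy `p` both functions solve the same linear equation, so comparison also applies
      -- with the roles exchanged.
      refine le_antisymm (hle p hp) (le_of_sub_le_mul_integral hα hf hg hh hW hVm (hJm p hp) hVW
        (hJW p hp) (hrate p hp) fun x => ?_)
      have hsub := continuationValue_sub (q := q) hα hf hg hh hW hVm (hJm p hp) hVW (hJW p hp) x
      rw [mul_assoc, ← hsub, markovReward_eq hα hp hq hf hg hh hW, hV x, ← h x]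
      linarith
  have hgreedy : ∃ p ∈ markovStrategies E, markovReward κ α p q f g h = V := by
    obtain ⟨p, hp, h⟩ := exists_greedy hAm hBm
    exact ⟨p, hp, (hiff p hp).2 h⟩
  refine ⟨A, B, hAm, hBm, ?_⟩
  obtain ⟨p', hp', hpV'⟩ := hgreedy
  have hJ : ∀ p ∈ markovStrategies E, ∀ x, expectedReward α f g h P X x
      (markovStoppingTime X (ξ 0) p) (markovStoppingTime X (ξ 1) q) =
      markovReward κ α p q f g h x := fun p hp x =>
    hset.expectedReward_eq hα.le hp hq hf hg hh hW x
  ext p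
  simp only [bestResponse, bestResponseAt, Set.mem_iInter, Set.mem_ofPred_eq]
  constructor
  · intro h
    have hp : p ∈ markovStrategies E := by
      -- For empty `E` the intersection over initial states is everything, so membership has to be
      -- checked directly.
      rcases isEmpty_or_nonempty E with hE | ⟨⟨x⟩⟩
      · exact ⟨measurable_of_empty _, fun x => hE.elim x⟩
      · exact (h x).1
    refine ⟨hp, (hiff p hp).1 (le_antisymm (hle p hp) fun x => ?_)⟩
    have := isMaxOn_iff.1 (h x).2 p' hp'
    rwa [hJ p hp, hJ p' hp', hpV'] at this
  · rintro ⟨hp, h⟩ x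
    refine ⟨hp, isMaxOn_iff.2 fun p' hp' => ?_⟩
    rw [hJ p hp, hJ p' hp', (hiff p hp).2 h]
    exact hle p' hp' x

end BestResponse

theorem mainTheorem10 {E Ω : Type*} [MeasurableSpace E] [MeasurableSpace Ω]
    (κ : Kernel E E) [IsMarkovKernel κ] (α : ℝ) (hα₀ : 0 < α) (hα₁ : α < 1)
    (P : E → Measure Ω) (X : ℕ → Ω → E) (ξ : Fin 2 → ℕ → Ω → ℝ) (T : Ω → ℕ)
    (hset : IsDynkinSetting κ α P X ξ T)
    (f g h : E → ℝ) (hf : Measurable f) (hg : Measurable g) (hh : Measurable h)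
    (hfi : IntegrableSupKilled P X T f) (hgi : IntegrableSupKilled P X T g)
    (hhi : IntegrableSupKilled P X T h)
    (p₂ : E → ℝ) (hp₂ : p₂ ∈ markovStrategies E) :
    (bestResponse α f g h P X ξ p₂).Nonempty ∧
    Convex ℝ (bestResponse α f g h P X ξ p₂) ∧
    IsClosed ((↑) ⁻¹' bestResponse α f g h P X ξ p₂ : Set (markovStrategies E)) := by
  have hW : ∀ x, totalPotential κ α f g h x ≠ ∞ := by
    intro x
    have hfin := fun (u : E → ℝ) (hu : Measurable u) (hui : IntegrableSupKilled P X T u) =>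
      hset.potential_enorm_ne_top hα₀.le hα₁ hu hui x
    rw [totalPotential, potential_add measurable_const hf.enorm,
      potential_add measurable_const hg.enorm]
    exact ENNReal.add_ne_top.2
      ⟨hfin f hf hfi, ENNReal.add_ne_top.2 ⟨hfin g hg hgi, hfin h hh hhi⟩⟩
  obtain ⟨A, B, hA, hB, hBR⟩ := hset.exists_bestResponse_eq hα₀ hp₂ hf hg hh hW
  rw [hBR]
  refine ⟨?_, ?_, ?_⟩
  · exact exists_greedy hA hB
  · rintro p ⟨hp, hpm⟩ p' ⟨hp', hpm'⟩ a b ha hb hab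
    refine ⟨⟨(hp.1.const_smul a).add (hp'.1.const_smul b),
      fun x => convex_Icc (0 : ℝ) 1 (hp.2 x) (hp'.2 x) ha hb hab⟩, fun x => ?_⟩
    simp only [Pi.add_apply, Pi.smul_apply, smul_eq_mul]
    -- The equation is affine, not linear, in `p x`: the last term corrects the constants, which
    -- acquire the weight `a + b`.
    linear_combination a * hpm x + b * hpm' x + (max (A x) (B x) - B x) * hab
  · have : ((↑) ⁻¹' {p ∈ markovStrategies E | ∀ x, p x * A x + (1 - p x) * B x = max (A x) (B x)} :
        Set (markovStrategies E)) = ⋂ x, {p : markovStrategies E |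
          (p : E → ℝ) x * A x + (1 - (p : E → ℝ) x) * B x = max (A x) (B x)} := by
      ext p
      simp
    rw [this]
    refine isClosed_iInter fun x => isClosed_eq ?_ continuous_const
    have hc : Continuous fun p : markovStrategies E => (p : E → ℝ) x :=
      (continuous_apply x).comp continuous_subtype_val
    exact (hc.mul continuous_const).add ((continuous_const.sub hc).mul continuous_const)
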